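/- An instance $I$ consists of a time budget $T\in\mathbb N_{>0}$ and articles $i=1,\dots,n$, each with a hint $h_i\in\mathbb N_{>0}$, a length $t_i\in\mathbb N_{>0}$ and an information rate $c_i:\{1,\dots,t_i\}\to\{1,\dots,h_i\}$. Reading article $i$ for a (possibly fractional) time $\tau\in[0,t_i]$ yields the information $G_i(\tau)=\sum_{j=1}^{\lfloor\tau\rfloor}c_i(j)+(\tau-\lfloor\tau\rfloor)\,c_i(\lceil\tau\rceil)$, where the last term is $0$ if $\tau$ is an integer. Let $\mathrm{Opt}(I)$ be the maximum of $\sum_i G_i(\tau_i)$ over all $\tau$ with $0\le\tau_i\le t_i$ and $\sum_i\tau_i\le T$. The accuracy $C\ge 1$ of the hints is the smallest number $C\ge1$ such that $h_i\le C\cdot\frac1{t_i}\sum_{j=1}^{t_i}c_i(j)$ for all $i$. For $g\in(0,1]$ put $t_i'=\min\{t_i,gT\}$. For a set $X$ of articles consider the fractional knapsack problem on $X$ with budget $T/2$: maximize $\sum_{i\in X}t_i'h_iy_i$ subject to $\sum_{i\in X}t_i'y_i\le T/2$ and $y_i\in[0,1]$. A threshold hint $\rho_X$ for $X$ is a real number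 such that, in an optimal solution $y$ of this problem, $y_i=1$ for all $i\in X$ with $h_i>\rho_X$ and $y_i=0$ for all $i\in X$ with $h_i<\rho_X$. The Threshold Algorithm works as follows. The articles arrive in uniformly random order, and independently $r$ is drawn from the binomial distribution $\mathrm{Bin}(n,1/2)$. The first $r$ articles form the sample $X$; nothing is read from them. Each later article $i$, in order of arrival, is read for the time $s_i=\min\{t_i,\,gT,\,T-\sum_j s_j\}$ (the sum is over the articles $j$ that arrived before $i$) if $h_i\ge\rho_X$, and is skipped ($s_i=0$) otherwise. Let $\mathrm{Alg}(I)=\sum_iG_i(s_i)$. Theorem. Let $g=0.0215$. Assume that every $c_i$ is non-increasing, that $t_i\le T$ for all $i$, that the hints $h_i$ are pairwise distinct, and that $\sum_i\min\{t_i,gT\}\ge \tfrac32T$. Then every set $X$ of articles has a threshold hint, and for every choice of the threshold hints $\rho_X$ the Threshold Algorithm is $246\,C$-competitive, i.e. $$\mathbb E[\mathrm{Alg}(I)]\ \ge\ \frac1{246\,C}\,\mathrm{Opt}(I),$$ and $246\,C<90.5\,\mathrm e\,C$. -/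

import Mathlib

/-- An instance of the problem of reading articles online: `n` articles, a time budget `T`, and for
each article `i` a hint `h i`, a length `t i` and an information rate `c i : [t i] → [h i]`.
Time steps are numbered from `1`; the values of `c i` outside `{1, …, t i}` carry no meaning and
are never used. -/
structure ReadingInstance where
  n : ℕ
  T : ℕ
  h : Fin n → ℕ
  t : Fin n → ℕ
  c : Fin n → ℕ → ℕ
  T_pos : 0 < T
  h_pos : ∀ i, 0 < h i
  t_pos : ∀ i, 0 < t i
  c_mem : ∀ i, ∀ j ∈ Finset.Icc 1 (t i), c i j ∈ Finset.Icc 1 (h i)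

namespace ReadingInstance

/-- The information rates are non-increasing. -/
def NonIncreasing (I : ReadingInstance) : Prop :=
  ∀ i, ∀ j k : ℕ, 1 ≤ j → j ≤ k → k ≤ I.t i → I.c i k ≤ I.c i j

/-- Information gained by reading article `i` from its beginning for the (possibly fractional)
time `τ`. -/
noncomputable def gain (I : ReadingInstance) (i : Fin I.n) (τ : ℝ) : ℝ :=
  (∑ j ∈ Finset.Icc 1 ⌊τ⌋₊, (I.c i j : ℝ)) + (I.c i ⌈τ⌉₊ : ℝ) * Int.fract τ

/-- A feasible fractional reading plan. -/
def Feasible (I : ReadingInstance) (τ : Fin I.n → ℝ) : Prop :=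
  (∀ i, 0 ≤ τ i ∧ τ i ≤ I.t i) ∧ ∑ i, τ i ≤ I.T

/-- The optimal offline value. -/
noncomputable def opt (I : ReadingInstance) : ℝ :=
  sSup {v : ℝ | ∃ τ : Fin I.n → ℝ, I.Feasible τ ∧ v = ∑ i, I.gain i (τ i)}

/-- The accuracy of the hints: the smallest `C ≥ 1` such that every hint is at most `C` times the
average information rate of its article. -/
noncomputable def accuracy (I : ReadingInstance) : ℝ :=
  sInf {C : ℝ | 1 ≤ C ∧
    ∀ i, (I.h i : ℝ) ≤ C * ∑ j ∈ Finset.Icc 1 (I.t i), (I.c i j : ℝ) / (I.t i : ℝ)}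

/-- The cut length `min {t i, g T}`. -/
noncomputable def cutLength (I : ReadingInstance) (g : ℝ) (i : Fin I.n) : ℝ :=
  min (I.t i : ℝ) (g * I.T)

/-- Feasible solutions of the fractional knapsack problem on the articles in `Q` with weights
`w i`, values `w i * h i` and capacity `x`. -/
def KnapsackFeasible (I : ReadingInstance) (w : Fin I.n → ℝ) (Q : Finset (Fin I.n)) (x : ℝ)
    (y : Fin I.n → ℝ) : Prop :=
  (∑ i, w i * y i ≤ x) ∧ (∀ i, i ∉ Q → y i = 0) ∧ ∀ i, 0 ≤ y i ∧ y i ≤ 1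

/-- Optimal solutions of the fractional knapsack problem. -/
def KnapsackOptimal (I : ReadingInstance) (w : Fin I.n → ℝ) (Q : Finset (Fin I.n)) (x : ℝ)
    (y : Fin I.n → ℝ) : Prop :=
  I.KnapsackFeasible w Q x y ∧
    ∀ z, I.KnapsackFeasible w Q x z → ∑ i, w i * I.h i * z i ≤ ∑ i, w i * I.h i * y i

/-- `ρ` is a threshold hint for the fractional knapsack problem on `Q`: in an optimal solution,
articles of `Q` with a larger hint are packed completely and those with a smaller hint are not
packed at all. -/
def IsThresholdHint (I : ReadingInstance) (w : Fin I.n → ℝ) (Q : Finset (Fin I.n)) (x : ℝ)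
    (ρ : ℝ) : Prop :=
  ∃ y, I.KnapsackOptimal w Q x y ∧
    ∀ i ∈ Q, (ρ < I.h i → y i = 1) ∧ ((I.h i : ℝ) < ρ → y i = 0)

/-- A rule that assigns to every possible sample `X` of articles a threshold hint of the fractional
knapsack problem on `X` with budget `T / 2` and the lengths cut at `g T`. -/
def IsThresholdRule (I : ReadingInstance) (g : ℝ) (ρ : Finset (Fin I.n) → ℝ) : Prop :=
  ∀ X, I.IsThresholdHint (I.cutLength g) X ((I.T : ℝ) / 2) (ρ X)

/-- The articles that appear in the first `r` rounds, when article `i` appears in round `π i`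
(rounds are numbered from `0`). -/
def sample (I : ReadingInstance) (π : Equiv.Perm (Fin I.n)) (r : ℕ) : Finset (Fin I.n) :=
  Finset.univ.filter fun i => (π i : ℕ) < r

/-- The time `s i` for which the Threshold Algorithm reads article `i`, on arrival order `π`,
sample size `r` and threshold hint `θ`: nothing is read from the sample; a later article whose hint
is at least `θ` is read for the time `min {t i, g T, remaining budget}`. -/
noncomputable def readTime (I : ReadingInstance) (g : ℝ) (π : Equiv.Perm (Fin I.n)) (r : ℕ)
    (θ : ℝ) (i : Fin I.n) : ℝ :=
  open Classical in
  if r ≤ (π i : ℕ) ∧ θ ≤ I.h i then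
    min (I.cutLength g i)
      ((I.T : ℝ) - ∑ j : {j : Fin I.n // π j < π i}, readTime I g π r θ j.1)
  else 0
termination_by (π i : ℕ)
decreasing_by exact j.2

/-- The information gained by the Threshold Algorithm with threshold rule `ρ` on arrival order `π`
and sample size `r`. -/
noncomputable def thresholdValue (I : ReadingInstance) (g : ℝ) (ρ : Finset (Fin I.n) → ℝ)
    (π : Equiv.Perm (Fin I.n)) (r : ℕ) : ℝ :=
  ∑ i, I.gain i (I.readTime g π r (ρ (I.sample π r)) i)

/-- The expected value of the Threshold Algorithm: the arrival order `π` is a uniformly random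
permutation, and the sample size `r` is independent of it with binomial distribution
`Bin(n, 1/2)`. -/
noncomputable def expectedThresholdValue (I : ReadingInstance) (g : ℝ)
    (ρ : Finset (Fin I.n) → ℝ) : ℝ :=
  ∑ π : Equiv.Perm (Fin I.n), (1 / (I.n.factorial : ℝ)) *
    ∑ r ∈ Finset.range (I.n + 1), ((I.n.choose r : ℝ) / 2 ^ I.n) * I.thresholdValue g ρ π r

end ReadingInstance

/-! Rank the articles by hint and cut their lengths to w_i = min(t_i, gT). Let L be the shortest top
segment of weight at least gT, and M the shortest of weight at least 3T/2. One article weighs at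
most gT, so L has weight below 2gT < T/2 and the weight W of M is below (3/2 + g)T. Shrinking any
plan by g makes it fit under the cut lengths with total at most gT, so L is worth at least g·Opt in
hints (`mul_opt_le`). The sample X is a uniformly random subset (`expectation_sample`). Let A be the
weight of X ∩ M. If A > W - T, then A > T/2, which puts the threshold above every hint outside M
(`lt_threshold`) and at or below every hint of L (`threshold_le`). The accepted articles lie in M \
X, of weight W - A < T, so all are read to their cut lengths, among them L \ X. As rates do not
increase, this yields at least 1/C of their hint value. Half of the value of L lies outside X in
expectation. The bad event A ≤ W - T is a deviation from the mean W/2, and Chebyshev bounds what it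
costs. At least 0.3 of the value of L survives, giving a factor below 246 C. -/

/-! ### Critical items and uniformly random subsets -/

open Finset in
/-- Among items ordered by an injective key, the critical item at which the accumulated weight of
the items with the largest keys reaches the level `b`. -/
theorem exists_critical_item {ι : Type*} (h : ι → ℕ) (w : ι → ℝ) (X : Finset ι) {b : ℝ}
    (hb : 0 < b) (hbX : b ≤ ∑ i ∈ X, w i) :
    ∃ k ∈ X, ∑ j ∈ X with h k < h j, w j < b ∧ b ≤ ∑ j ∈ X with h k ≤ h j, w j := by
  classical
  have hX : X.Nonempty := by
    rw [Finset.nonempty_iff_ne_empty]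
    rintro rfl
    simp at hbX
    linarith
  obtain ⟨m, hm, hmin⟩ := X.exists_min_image h hX
  let K := X.filter fun k => b ≤ ∑ j ∈ X with h k ≤ h j, w j
  have hK : K.Nonempty := by
    refine ⟨m, mem_filter.2 ⟨hm, ?_⟩⟩
    rwa [filter_true_of_mem hmin]
  obtain ⟨k, hk, hmax⟩ := K.exists_max_image h hK
  obtain ⟨hkX, hkb⟩ := mem_filter.1 hk
  refine ⟨k, hkX, ?_, hkb⟩
  by_contra! hlt
  have hne : (X.filter fun j => h k < h j).Nonempty := by
    rw [Finset.nonempty_iff_ne_empty]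
    intro h0
    rw [h0, sum_empty] at hlt
    linarith
  -- The next larger key would also reach the level, against the maximality of `k`.
  obtain ⟨l, hl, hlmin⟩ := (X.filter fun j => h k < h j).exists_min_image h hne
  obtain ⟨hlX, hkl⟩ := mem_filter.1 hl
  have heq : (X.filter fun j => h l ≤ h j) = X.filter fun j => h k < h j := by
    ext j
    simp only [mem_filter]
    constructor
    · rintro ⟨h1, h2⟩
      exact ⟨h1, hkl.trans_le h2⟩
    · rintro ⟨h1, h2⟩
      exact ⟨h1, hlmin j (mem_filter.2 ⟨h1, h2⟩)⟩
  have := hmax l (mem_filter.2 ⟨hlX, by rwa [heq]⟩)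
  omega

-- Distinct hints make the weight jump at a critical item by that single item, so it overshoots its
-- level by at most one cut length.
open Finset in
theorem sum_filter_le_eq_add {ι : Type*} {h : ι → ℕ} (hinj : Function.Injective h) (w : ι → ℝ)
    {X : Finset ι} {k : ι} (hk : k ∈ X) :
    ∑ j ∈ X with h k ≤ h j, w j = w k + ∑ j ∈ X with h k < h j, w j := by
  classical
  rw [← sum_insert (by simp)]
  congr 1
  ext j
  simp only [mem_filter, mem_insert]
  constructor
  · rintro ⟨h1, h2⟩
    rcases h2.eq_or_lt with h3 | h3
    · exact Or.inl (hinj h3).symm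
    · exact Or.inr ⟨h1, h3⟩
  · rintro (rfl | ⟨h1, h2⟩)
    · exact ⟨hk, le_rfl⟩
    · exact ⟨h1, h2.le⟩

open Finset in
/-- The second moment, around a shifted mean, of the weight of a uniformly random subset. -/
theorem sum_powerset_sq_deviation {ι : Type*} [DecidableEq ι] (a : ι → ℝ) (S : Finset ι) (b : ℝ) :
    ∑ X ∈ S.powerset, (∑ j ∈ X, a j - (∑ j ∈ S, a j) / 2 + b) ^ 2
      = 2 ^ #S * ((∑ j ∈ S, a j ^ 2) / 4 + b ^ 2) := by
  induction S using Finset.induction_on generalizing b with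
  | empty => simp
  | insert k S hk ih =>
    rw [sum_powerset_insert hk, sum_insert hk, sum_insert hk, card_insert_of_notMem hk]
    -- Leaving out or including `k` shifts `b` by ∓`a k / 2`; the cross terms cancel. This is why
    -- the induction needs a general `b`.
    have h1 : ∑ X ∈ S.powerset, (∑ j ∈ X, a j - (a k + ∑ j ∈ S, a j) / 2 + b) ^ 2
        = ∑ X ∈ S.powerset, (∑ j ∈ X, a j - (∑ j ∈ S, a j) / 2 + (b - a k / 2)) ^ 2 :=
      sum_congr rfl fun X _ => by ring
    have h2 : ∑ X ∈ S.powerset, (∑ j ∈ insert k X, a j - (a k + ∑ j ∈ S, a j) / 2 + b) ^ 2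
        = ∑ X ∈ S.powerset, (∑ j ∈ X, a j - (∑ j ∈ S, a j) / 2 + (b + a k / 2)) ^ 2 := by
      refine sum_congr rfl fun X hX => ?_
      rw [sum_insert fun h => hk (mem_powerset.1 hX h)]
      ring
    rw [h1, h2, ih, ih]
    ring

open Finset in
/-- A uniformly random subset misses half of every total in expectation. -/
theorem sum_finset_sum_sdiff {ι : Type*} [Fintype ι] [DecidableEq ι] (S : Finset ι) (v : ι → ℝ) :
    ∑ X : Finset ι, ∑ i ∈ S \ X, v i = 2 ^ Fintype.card ι * ((∑ i ∈ S, v i) / 2) := by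
  have hcompl : ∑ X : Finset ι, ∑ i ∈ S \ X, v i = ∑ X : Finset ι, ∑ i ∈ S ∩ X, v i := by
    refine Fintype.sum_bijective compl compl_bijective _ _ fun X => ?_
    rw [sdiff_eq_inter_compl]
  have hadd : ∑ X : Finset ι, ∑ i ∈ S \ X, v i + ∑ X : Finset ι, ∑ i ∈ S ∩ X, v i
      = 2 ^ Fintype.card ι * ∑ i ∈ S, v i := by
    rw [← sum_add_distrib]
    have : ∀ X : Finset ι, ∑ i ∈ S \ X, v i + ∑ i ∈ S ∩ X, v i = ∑ i ∈ S, v i := fun X => by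
      rw [add_comm, sum_inter_add_sum_sdiff]
    simp [this]
  linarith

namespace ReadingInstance

variable (I : ReadingInstance)

/-! ### The sample as a uniformly random set -/

open Finset in
theorem card_sample (π : Equiv.Perm (Fin I.n)) {r : ℕ} (hr : r ≤ I.n) : #(I.sample π r) = r := by
  have : #({i | (π i : ℕ) < r} : Finset (Fin I.n)) = #({i | (i : ℕ) < r} : Finset (Fin I.n)) :=
    card_bij' (fun i _ => π i) (fun i _ => π.symm i) (by simp) (by simp) (by simp) (by simp)
  rw [sample, this, Fin.card_filter_val_lt, min_eq_right hr]

open Finset in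
/-- All samples of the same size are equally likely. -/
theorem card_sample_fiber_mul_choose (X : Finset (Fin I.n)) :
    #{π : Equiv.Perm (Fin I.n) | I.sample π #X = X} * I.n.choose #X = I.n.factorial := by
  have hsym : ∀ Y ∈ powersetCard #X (univ : Finset (Fin I.n)),
      #{π : Equiv.Perm (Fin I.n) | I.sample π #X = Y}
        = #{π : Equiv.Perm (Fin I.n) | I.sample π #X = X} := by
    intro Y hY
    -- Relabelling articles by a permutation that carries `X` to `Y` is a bijection between the two
    -- fibres.
    obtain ⟨σ, hσ⟩ : ∃ σ : Equiv.Perm (Fin I.n), ∀ i, σ i ∈ Y ↔ i ∈ X := by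
      have e : {i // i ∈ X} ≃ {i // i ∈ Y} :=
        Finset.equivOfCardEq (mem_powersetCard.1 hY).2.symm
      refine ⟨e.extendSubtype, fun i => ⟨fun h => ?_, fun h => e.extendSubtype_mem i h⟩⟩
      by_contra hi
      exact e.extendSubtype_not_mem i hi h
    refine card_bij' (fun π _ => σ.trans π) (fun π _ => σ.symm.trans π) ?_ ?_ ?_ ?_
    · intro π hπ
      simp only [mem_filter, mem_univ, true_and, sample, Finset.ext_iff] at hπ ⊢
      intro i
      rw [Equiv.trans_apply, hπ, hσ]
    · intro π hπ
      simp only [mem_filter, mem_univ, true_and, sample, Finset.ext_iff] at hπ ⊢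
      intro i
      rw [Equiv.trans_apply, hπ, ← hσ, Equiv.apply_symm_apply]
    · intro π _
      ext i
      simp
    · intro π _
      ext i
      simp
  have hcard := card_eq_sum_card_fiberwise (s := (univ : Finset (Equiv.Perm (Fin I.n))))
    (t := powersetCard #X (univ : Finset (Fin I.n))) (f := fun π => I.sample π #X) (by
      intro π _
      exact mem_powersetCard.2
        ⟨subset_univ _, I.card_sample π (by simpa using card_le_univ X)⟩)
  rw [sum_congr rfl hsym, sum_const, card_powersetCard, card_univ, Fintype.card_perm, card_univ,
    Fintype.card_fin, smul_eq_mul, mul_comm] at hcard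
  exact hcard.symm

open Finset in
/-- The sample is a uniformly random set of articles. -/
theorem expectation_sample (F : Finset (Fin I.n) → ℝ) :
    ∑ π : Equiv.Perm (Fin I.n), (1 / (I.n.factorial : ℝ)) *
      ∑ r ∈ range (I.n + 1), ((I.n.choose r : ℝ) / 2 ^ I.n) * F (I.sample π r)
      = (∑ X, F X) / 2 ^ I.n := by
  have hcardle : ∀ X : Finset (Fin I.n), #X ∈ range (I.n + 1) := fun X => by
    have := card_le_univ X
    simp at this ⊢
    omega
  have hsample : ∀ r ∈ range (I.n + 1), ∀ π, #(I.sample π r) = r := by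
    intro r hr π
    exact I.card_sample π (Nat.lt_succ_iff.1 (mem_range.1 hr))
  have hfix : ∀ r ∈ range (I.n + 1),
      ∑ π : Equiv.Perm (Fin I.n), (1 / (I.n.factorial : ℝ)) * ((I.n.choose r : ℝ) * F (I.sample π r))
        = ∑ X with #X = r, F X := by
    intro r hr
    rw [← sum_fiberwise_of_maps_to (s := univ) (t := ({X | #X = r} : Finset (Finset (Fin I.n))))
      (g := fun π => I.sample π r) (fun π _ => by simpa using hsample r hr π)]
    refine sum_congr rfl fun X hX => ?_
    obtain rfl : #X = r := by simpa using hX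
    have hc : (#{π : Equiv.Perm (Fin I.n) | I.sample π #X = X} : ℝ) * I.n.choose #X
        = I.n.factorial := by exact_mod_cast I.card_sample_fiber_mul_choose X
    have hf : (I.n.factorial : ℝ) ≠ 0 := by positivity
    rw [sum_congr rfl (g := fun _ => (1 / (I.n.factorial : ℝ)) * ((I.n.choose #X : ℝ) * F X))
      (by
        intro π hπ
        rw [(mem_filter.1 hπ).2]), sum_const, nsmul_eq_mul]
    field_simp
    rw [← hc]
  calc _ = ∑ r ∈ range (I.n + 1), (∑ π : Equiv.Perm (Fin I.n),
        (1 / (I.n.factorial : ℝ)) * ((I.n.choose r : ℝ) * F (I.sample π r))) / 2 ^ I.n := by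
        simp_rw [mul_sum, sum_div]
        rw [sum_comm]
        refine sum_congr rfl fun r _ => sum_congr rfl fun π _ => by ring
    _ = _ := by
        rw [← sum_div, sum_congr rfl hfix]
        congr 1
        rw [sum_fiberwise_of_maps_to (fun X _ => hcardle X)]

/-! ### Information gain, hints and accuracy -/

theorem gain_nonneg (i : Fin I.n) (τ : ℝ) : 0 ≤ I.gain i τ := by
  unfold gain
  have := Int.fract_nonneg τ
  positivity

open Finset in
theorem gain_eq (i : Fin I.n) {τ : ℝ} (h0 : 0 ≤ τ) :
    I.gain i τ = ∑ j ∈ Icc 1 ⌊τ⌋₊, (I.c i j : ℝ) + (I.c i (⌊τ⌋₊ + 1) : ℝ) * (τ - ⌊τ⌋₊) := by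
  have hfr : Int.fract τ = τ - ⌊τ⌋₊ := by
    rw [Int.fract, natCast_floor_eq_intCast_floor h0]
  unfold gain
  rw [hfr]
  rcases (Nat.floor_le h0).eq_or_lt with h | h
  · rw [h]
    simp
  · have : ⌈τ⌉₊ = ⌊τ⌋₊ + 1 := by
      apply le_antisymm (Nat.ceil_le_floor_add_one τ)
      exact Nat.lt_ceil.2 h
    rw [this]

open Finset in
theorem gain_le (i : Fin I.n) {τ : ℝ} (h0 : 0 ≤ τ) (hτ : τ ≤ I.t i) :
    I.gain i τ ≤ I.h i * τ := by
  have hfl : ⌊τ⌋₊ ≤ I.t i := Nat.floor_le_of_le hτ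
  have hc : ∀ j ∈ Icc 1 (I.t i), (I.c i j : ℝ) ≤ I.h i := fun j hj => by
    exact_mod_cast (mem_Icc.1 (I.c_mem i j hj)).2
  have hS : ∑ j ∈ Icc 1 ⌊τ⌋₊, (I.c i j : ℝ) ≤ ⌊τ⌋₊ * I.h i := by
    calc _ ≤ ∑ j ∈ Icc 1 ⌊τ⌋₊, (I.h i : ℝ) :=
          sum_le_sum fun j hj => hc j (Icc_subset_Icc_right hfl hj)
      _ = _ := by simp
  have hf0 := Nat.floor_le h0
  rw [I.gain_eq i h0]
  have hlast : (I.c i (⌊τ⌋₊ + 1) : ℝ) * (τ - ⌊τ⌋₊) ≤ I.h i * (τ - ⌊τ⌋₊) := by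
    rcases hf0.eq_or_lt with h | h
    · rw [← h]
      simp
    · have : ⌊τ⌋₊ < I.t i := by
        exact_mod_cast h.trans_le hτ
      exact mul_le_mul_of_nonneg_right (hc _ (mem_Icc.2 ⟨by omega, this⟩)) (by linarith)
  nlinarith

open Finset in
/-- Reading a prefix yields at least the average rate of the article. -/
theorem mul_sum_le_length_mul_gain (hmono : I.NonIncreasing) (i : Fin I.n) {τ : ℝ} (h0 : 0 ≤ τ)
    (hτ : τ ≤ I.t i) :
    τ * ∑ j ∈ Icc 1 (I.t i), (I.c i j : ℝ) ≤ I.t i * I.gain i τ := by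
  rw [I.gain_eq i h0]
  have hfl : ⌊τ⌋₊ ≤ I.t i := Nat.floor_le_of_le hτ
  have hf0 := Nat.floor_le h0
  have hf1 := Nat.lt_floor_add_one τ
  set k := ⌊τ⌋₊
  rcases hfl.eq_or_lt with hk | hk
  · have : τ = I.t i := le_antisymm hτ (by rw [← hk]; exact hf0)
    rw [this, hk]
    simp
  · have hkt : (k : ℝ) ≤ I.t i := by exact_mod_cast hfl
    have hsplit : ∑ j ∈ Icc 1 (I.t i), (I.c i j : ℝ)
        = ∑ j ∈ Icc 1 k, (I.c i j : ℝ) + ∑ j ∈ Icc (k + 1) (I.t i), (I.c i j : ℝ) := by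
      have := sum_Ioc_consecutive (fun j => (I.c i j : ℝ)) (Nat.zero_le k) hfl
      simpa [← Finset.Icc_add_one_left_eq_Ioc] using this.symm
    -- The rate at step `k + 1` separates the two parts: at most the average before it, at least the
    -- average from it on.
    have hlow : k * (I.c i (k + 1) : ℝ) ≤ ∑ j ∈ Icc 1 k, (I.c i j : ℝ) := by
      have := card_nsmul_le_sum (Icc 1 k) (fun j => (I.c i j : ℝ)) (I.c i (k + 1) : ℝ)
        fun j hj => by
          have := mem_Icc.1 hj
          exact_mod_cast hmono i j (k + 1) this.1 (by omega) hk
      simpa using this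
    have hup : ∑ j ∈ Icc (k + 1) (I.t i), (I.c i j : ℝ) ≤ (I.t i - k) * (I.c i (k + 1) : ℝ) := by
      have := sum_le_card_nsmul (Icc (k + 1) (I.t i)) (fun j => (I.c i j : ℝ))
        (I.c i (k + 1) : ℝ) fun j hj => by
          have := mem_Icc.1 hj
          exact_mod_cast hmono i (k + 1) j (by omega) this.1 this.2
      simpa [Nat.cast_sub hfl] using this
    rw [hsplit]
    have e1 := mul_le_mul_of_nonneg_left hlow (sub_nonneg.2 hτ)
    have e2 := mul_le_mul_of_nonneg_left hup h0
    nlinarith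

open Finset in
theorem accuracy_spec : 1 ≤ I.accuracy ∧
    ∀ i, (I.h i : ℝ) * I.t i ≤ I.accuracy * ∑ j ∈ Icc 1 (I.t i), (I.c i j : ℝ) := by
  have ht : ∀ i, (0 : ℝ) < I.t i := fun i => by exact_mod_cast I.t_pos i
  have hS : ∀ i, (I.t i : ℝ) ≤ ∑ j ∈ Icc 1 (I.t i), (I.c i j : ℝ) := fun i => by
    have := card_nsmul_le_sum (Icc 1 (I.t i)) (fun j => (I.c i j : ℝ)) 1
      fun j hj => by exact_mod_cast (mem_Icc.1 (I.c_mem i j hj)).1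
    simpa using this
  have hiff : ∀ C : ℝ, ∀ i, (I.h i : ℝ) ≤ C * ∑ j ∈ Icc 1 (I.t i), (I.c i j : ℝ) / (I.t i : ℝ) ↔
      (I.h i : ℝ) * I.t i ≤ C * ∑ j ∈ Icc 1 (I.t i), (I.c i j : ℝ) := fun C i => by
    rw [← sum_div, ← mul_div_assoc, le_div_iff₀ (ht i)]
  have hne : {C : ℝ | 1 ≤ C ∧
      ∀ i, (I.h i : ℝ) ≤ C * ∑ j ∈ Icc 1 (I.t i), (I.c i j : ℝ) / (I.t i : ℝ)}.Nonempty := by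
    -- Every rate is at least 1, so any number above all hints is an admissible accuracy.
    refine ⟨1 + ∑ i, (I.h i : ℝ), ?_, fun i => ?_⟩
    · have : (0 : ℝ) ≤ ∑ i, (I.h i : ℝ) := by positivity
      linarith
    · rw [hiff]
      have : (I.h i : ℝ) ≤ ∑ i, (I.h i : ℝ) :=
        single_le_sum (f := fun i => (I.h i : ℝ)) (fun j _ => by positivity) (mem_univ i)
      exact mul_le_mul (by linarith) (hS i) (ht i).le (by positivity)
  refine ⟨le_csInf hne fun C hC => hC.1, fun i => ?_⟩
  have hpos := (ht i).trans_le (hS i)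
  rw [← div_le_iff₀ hpos]
  refine le_csInf hne fun C hC => ?_
  rw [div_le_iff₀ hpos, ← hiff]
  exact hC.2 i

theorem hint_mul_le_accuracy_mul_gain (hmono : I.NonIncreasing) (i : Fin I.n) {τ : ℝ} (h0 : 0 ≤ τ)
    (hτ : τ ≤ I.t i) : τ * I.h i ≤ I.accuracy * I.gain i τ := by
  have ht : (0 : ℝ) < I.t i := by exact_mod_cast I.t_pos i
  obtain ⟨hC, hacc⟩ := I.accuracy_spec
  have h1 := mul_le_mul_of_nonneg_left (hacc i) h0
  have h2 := mul_le_mul_of_nonneg_left (I.mul_sum_le_length_mul_gain hmono i h0 hτ)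
    (zero_le_one.trans hC)
  refine le_of_mul_le_mul_left ?_ ht
  linarith

/-! ### Threshold hints of the fractional knapsack -/

theorem cutLength_pos {g : ℝ} (hg : 0 < g) (i : Fin I.n) : 0 < I.cutLength g i := by
  have h1 : (0 : ℝ) < I.t i := by exact_mod_cast I.t_pos i
  have h2 : (0 : ℝ) < I.T := by exact_mod_cast I.T_pos
  exact lt_min h1 (mul_pos hg h2)

open Finset in
/-- A fractional packing that fills the capacity in the order of the hints is optimal. -/
theorem exists_isThresholdHint {w : Fin I.n → ℝ} (hw : ∀ i, 0 < w i)
    (hinj : Function.Injective I.h) (X : Finset (Fin I.n)) {x : ℝ} (hx : 0 < x) :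
    ∃ ρ, I.IsThresholdHint w X x ρ := by
  rcases le_total (∑ i ∈ X, w i) x with hX | hX
  -- Everything fits, and 0 lies below all hints.
  · refine ⟨0, fun i => if i ∈ X then 1 else 0, ⟨⟨?_, ?_, ?_⟩, ?_⟩, ?_⟩
    · simpa using hX
    · intro i hi
      simp [hi]
    · intro i
      dsimp only
      split_ifs <;> norm_num
    · rintro z ⟨-, hz, hz'⟩
      refine sum_le_sum fun i _ => mul_le_mul_of_nonneg_left ?_ (by have := hw i; positivity)
      dsimp only
      split_ifs with hi
      · exact (hz' i).2
      · exact (hz i hi).le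
    · intro i hi
      refine ⟨fun _ => by simp [hi], fun h => absurd h (by simp)⟩
  · obtain ⟨k, hk, hlt, hle⟩ := exists_critical_item I.h w X hx hX
    rw [sum_filter_le_eq_add hinj w hk] at hle
    set s := ∑ j ∈ X with I.h k < I.h j, w j with hs
    set y : Fin I.n → ℝ := fun i =>
      if i = k then (x - s) / w k else if i ∈ X ∧ I.h k < I.h i then 1 else 0 with hy
    have hyk : y k = (x - s) / w k := by simp [hy]
    have hsum : ∑ i, w i * y i = x := by
      have hrest : ∑ i ∈ univ.erase k, w i * y i = s := by
        rw [hs, ← sum_subset (s₁ := X.filter fun j => I.h k < I.h j)]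
        · refine sum_congr rfl fun i hi => ?_
          obtain ⟨hiX, hi⟩ := mem_filter.1 hi
          have hik : i ≠ k := by
            rintro rfl
            omega
          simp [hy, hiX, hi, hik]
        · intro i hi
          have := (mem_filter.1 hi).2
          refine mem_erase.2 ⟨?_, mem_univ i⟩
          rintro rfl
          omega
        · intro i hi hi'
          have hik := ne_of_mem_erase hi
          simp only [mem_filter] at hi'
          simp [hy, hik, hi']
      rw [← add_sum_erase _ _ (mem_univ k), hrest, hyk, mul_div_cancel₀ _ (hw k).ne']
      ring
    have hy01 : ∀ i, 0 ≤ y i ∧ y i ≤ 1 := by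
      intro i
      simp only [hy]
      split_ifs
      · exact ⟨div_nonneg (by linarith) (hw k).le, (div_le_one (hw k)).2 (by linarith)⟩
      · norm_num
      · norm_num
    refine ⟨I.h k, y, ⟨⟨hsum.le, ?_, hy01⟩, ?_⟩, ?_⟩
    · intro i hi
      have : i ≠ k := fun h => hi (h ▸ hk)
      simp [hy, hi, this]
    · rintro z ⟨hz1, hz2, hz3⟩
      -- The critical hint acts as a dual price per unit of capacity: `y` takes all that is worth
      -- more and nothing worth less.
      have key : ∀ i ∈ univ, (I.h k : ℝ) * (w i * y i - w i * z i)
          ≤ w i * I.h i * y i - w i * I.h i * z i := by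
        intro i _
        by_cases hiX : i ∈ X
        · rcases lt_trichotomy (I.h i) (I.h k) with h | h | h
          · have hi : i ≠ k := by
              rintro rfl
              omega
            have : y i = 0 := by simp [hy, hi, h.le]
            rw [this]
            have hc : (I.h i : ℝ) ≤ I.h k := by exact_mod_cast h.le
            have := mul_nonneg (mul_nonneg (hw i).le (hz3 i).1) (sub_nonneg.2 hc)
            linarith
          · rw [h]
            linarith
          · have hi : i ≠ k := by
              rintro rfl
              omega
            have : y i = 1 := by simp [hy, hi, h, hiX]
            rw [this]
            have hc : (I.h k : ℝ) ≤ I.h i := by exact_mod_cast h.le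
            have := mul_nonneg (mul_nonneg (hw i).le (sub_nonneg.2 (hz3 i).2)) (sub_nonneg.2 hc)
            linarith
        · have hi : i ≠ k := fun h => hiX (h ▸ hk)
          simp [hy, hz2 i hiX, hiX, hi]
      have := sum_le_sum key
      rw [← mul_sum, sum_sub_distrib, sum_sub_distrib, hsum] at this
      have := mul_nonneg (Nat.cast_nonneg (α := ℝ) (I.h k)) (sub_nonneg.2 hz1)
      linarith
    · intro i hiX
      simp only [Nat.cast_lt]
      constructor
      · intro h
        have hi : i ≠ k := by
          rintro rfl
          omega
        simp [hy, hi, h, hiX]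
      · intro h
        have hi : i ≠ k := by
          rintro rfl
          omega
        simp [hy, hi, h.le]

open Finset in
/-- If the articles with hint at least `m` in the sample exceed the capacity, the threshold is above
every smaller hint. -/
theorem lt_threshold {w : Fin I.n → ℝ} (hw : ∀ i, 0 < w i) {X : Finset (Fin I.n)} {x ρ : ℝ}
    (hρ : I.IsThresholdHint w X x ρ) {m : ℕ} (hX : x < ∑ i ∈ X with m ≤ I.h i, w i) {l : ℕ}
    (hl : l < m) : (l : ℝ) < ρ := by
  obtain ⟨y, ⟨⟨hy1, hy2, hy3⟩, -⟩, hy⟩ := hρ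
  by_contra! hlt
  have : ∑ i ∈ X with m ≤ I.h i, w i ≤ ∑ i, w i * y i := by
    calc _ = ∑ i ∈ X with m ≤ I.h i, w i * y i := by
          refine sum_congr rfl fun i hi => ?_
          obtain ⟨hiX, him⟩ := mem_filter.1 hi
          rw [(hy i hiX).1 (hlt.trans_lt (by exact_mod_cast hl.trans_le him)), mul_one]
      _ ≤ _ := sum_le_sum_of_subset_of_nonneg (subset_univ _)
          fun i _ _ => mul_nonneg (hw i).le (hy3 i).1
  linarith

open Finset in
/-- If the sample exceeds the capacity, every article whose predecessors in the order of the hints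
do not fill the capacity is at or above the threshold. -/
theorem threshold_le {w : Fin I.n → ℝ} (hw : ∀ i, 0 < w i) {X : Finset (Fin I.n)} {x ρ : ℝ}
    (hρ : I.IsThresholdHint w X x ρ) (hX : x < ∑ i ∈ X, w i) {l : ℕ}
    (hl : ∑ i with l ≤ I.h i, w i < x) : ρ ≤ l := by
  obtain ⟨y, ⟨⟨hy1, hy2, hy3⟩, hopt⟩, hy⟩ := hρ
  by_contra! hlt
  have hpack : ∑ i, w i * y i < x := by
    refine lt_of_le_of_lt ?_ hl
    rw [sum_filter]
    refine sum_le_sum fun i _ => ?_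
    split_ifs with h
    · exact mul_le_of_le_one_right (hw i).le (hy3 i).2
    · by_cases hiX : i ∈ X
      · rw [(hy i hiX).2 (lt_trans (by exact_mod_cast not_le.1 h) hlt), mul_zero]
      · rw [hy2 i hiX, mul_zero]
  obtain ⟨k, hkX, hk⟩ : ∃ k ∈ X, y k < 1 := by
    by_contra! hall
    have : ∑ i ∈ X, w i ≤ ∑ i, w i * y i :=
      calc _ ≤ ∑ i ∈ X, w i * y i :=
            sum_le_sum fun i hi => le_mul_of_one_le_right (hw i).le (hall i hi)
        _ ≤ _ := sum_le_sum_of_subset_of_nonneg (subset_univ _)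
            fun i _ _ => mul_nonneg (hw i).le (hy3 i).1
    linarith
  -- A threshold above `l` leaves capacity unused while some sample article is not fully packed;
  -- packing `ε` more of it contradicts optimality.
  set ε := min (1 - y k) ((x - ∑ i, w i * y i) / w k) with hε
  have hε0 : 0 < ε := lt_min (by linarith) (div_pos (by linarith) (hw k))
  have hε1 : ε ≤ 1 - y k := min_le_left _ _
  have hε2 : w k * ε ≤ x - ∑ i, w i * y i := by
    have := (le_div_iff₀ (hw k)).1 (min_le_right (1 - y k) ((x - ∑ i, w i * y i) / w k))
    linarith
  have hz : ∀ v : Fin I.n → ℝ,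
      ∑ i, v i * (y i + if i = k then ε else 0) = ∑ i, v i * y i + v k * ε := fun v => by
    simp [mul_add, sum_add_distrib]
  have := hopt (fun i => y i + if i = k then ε else 0) ⟨by rw [hz]; linarith, fun i hi => ?_,
    fun i => ?_⟩
  · rw [hz fun i => w i * I.h i] at this
    have hh : (0 : ℝ) < I.h k := by exact_mod_cast I.h_pos k
    have := mul_pos (mul_pos (hw k) hh) hε0
    linarith
  · have : i ≠ k := fun h => hi (h ▸ hkX)
    simp [this, hy2 i hi]
  · dsimp only
    split_ifs with h
    · subst h
      exact ⟨by linarith [(hy3 i).1], by linarith⟩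
    · simpa using hy3 i

/-! ### Reading to the cut length and comparison with the optimum -/

open Finset in
/-- An article that is not skipped is read for its full cut length if all articles that are not
skipped fit into the budget. -/
theorem readTime_eq_cutLength {g : ℝ} (hg : 0 < g) (π : Equiv.Perm (Fin I.n)) {r : ℕ} {θ : ℝ}
    (hfit : ∑ j with r ≤ (π j : ℕ) ∧ θ ≤ I.h j, I.cutLength g j ≤ I.T) {i : Fin I.n}
    (hi : r ≤ (π i : ℕ) ∧ θ ≤ I.h i) : I.readTime g π r θ i = I.cutLength g i := by
  classical
  have hle : ∀ j, I.readTime g π r θ j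
      ≤ if r ≤ (π j : ℕ) ∧ θ ≤ I.h j then I.cutLength g j else 0 := by
    intro j
    rw [readTime]
    split_ifs
    · exact min_le_left _ _
    · exact le_rfl
  have hsum : ∑ j : {j : Fin I.n // π j < π i}, I.readTime g π r θ j.1 + I.cutLength g i
      ≤ I.T := by
    refine le_trans ?_ hfit
    rw [← sum_subtype (univ.filter fun j => π j < π i) (by simp)
      (fun j => I.readTime g π r θ j)]
    calc _ ≤ ∑ j with π j < π i, (if r ≤ (π j : ℕ) ∧ θ ≤ I.h j then I.cutLength g j else 0)
          + I.cutLength g i := by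
          gcongr with j hj
          exact hle j
      _ = ∑ j ∈ insert i (univ.filter fun j => π j < π i),
            (if r ≤ (π j : ℕ) ∧ θ ≤ I.h j then I.cutLength g j else 0) := by
          rw [sum_insert (by simp), if_pos hi, add_comm]
      _ ≤ ∑ j, (if r ≤ (π j : ℕ) ∧ θ ≤ I.h j then I.cutLength g j else 0) :=
          sum_le_sum_of_subset_of_nonneg (subset_univ _) fun j _ _ => by
            split_ifs
            · exact (I.cutLength_pos hg j).le
            · exact le_rfl
      _ = _ := by rw [sum_filter]
  rw [readTime, if_pos hi]
  exact min_eq_left (by linarith)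

open Finset in
/-- Cutting the lengths at `g T` costs at most a factor `1 / g`. -/
theorem mul_opt_le {g : ℝ} (hg0 : 0 < g) (hg1 : g ≤ 1) {l : ℕ}
    (hl : g * I.T ≤ ∑ i with l ≤ I.h i, I.cutLength g i) :
    g * I.opt ≤ ∑ i with l ≤ I.h i, I.cutLength g i * I.h i := by
  have hT : (0 : ℝ) < I.T := by exact_mod_cast I.T_pos
  rw [← le_div_iff₀' hg0]
  refine csSup_le ⟨_, fun _ => 0, ⟨fun i => ⟨le_rfl, by positivity⟩, by simp [hT.le]⟩, rfl⟩ ?_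
  rintro _ ⟨τ, ⟨hτ, hτT⟩, rfl⟩
  rw [le_div_iff₀' hg0]
  refine (mul_le_mul_of_nonneg_left
    (sum_le_sum fun i _ => I.gain_le i (hτ i).1 (hτ i).2) hg0.le).trans ?_
  have hcut : ∀ i, g * τ i ≤ I.cutLength g i := fun i => by
    refine le_min ((mul_le_of_le_one_left (hτ i).1 hg1).trans (hτ i).2) ?_
    refine mul_le_mul_of_nonneg_left (le_trans ?_ hτT) hg0.le
    exact single_le_sum (f := τ) (fun j _ => (hτ j).1) (mem_univ i)
  -- Price time at `l`: the top segment holds at least as much time as the scaled plan, and every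
  -- exchange gains at least this price.
  have key : ∀ i ∈ univ, (l : ℝ) * ((if l ≤ I.h i then I.cutLength g i else 0) - g * τ i)
      ≤ (if l ≤ I.h i then I.cutLength g i * I.h i else 0) - g * (I.h i * τ i) := by
    intro i _
    split_ifs with h
    · have hc : (l : ℝ) ≤ I.h i := by exact_mod_cast h
      have := mul_nonneg (sub_nonneg.2 hc) (sub_nonneg.2 (hcut i))
      linarith
    · have hc : (I.h i : ℝ) ≤ l := by exact_mod_cast (not_le.1 h).le
      have := mul_nonneg (sub_nonneg.2 hc) (mul_nonneg hg0.le (hτ i).1)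
      linarith
  have hsum := sum_le_sum key
  rw [← mul_sum, sum_sub_distrib, sum_sub_distrib, ← sum_filter, ← sum_filter, ← mul_sum,
    ← mul_sum] at hsum
  have h2 := mul_le_mul_of_nonneg_left hτT hg0.le
  have h3 := mul_nonneg (Nat.cast_nonneg (α := ℝ) l)
    (sub_nonneg.2 (h2.trans hl))
  linarith

open Finset in
/-- The algorithm reads all articles with hint at least `l` outside the sample, unless the weight of
the sample among the articles with hint at least `m` deviates from its mean. -/
theorem le_accuracy_mul_thresholdValue {g : ℝ} (hg : 0 < g) (hmono : I.NonIncreasing)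
    {ρ : Finset (Fin I.n) → ℝ} (hρ : I.IsThresholdRule g ρ) {l m : ℕ}
    (hl : ∑ i with l ≤ I.h i, I.cutLength g i < (I.T : ℝ) / 2)
    (hm : 3 * (I.T : ℝ) / 2 ≤ ∑ i with m ≤ I.h i, I.cutLength g i) {δ : ℝ} (hδ : 0 < δ)
    (hm' : ∑ i with m ≤ I.h i, I.cutLength g i ≤ 2 * I.T - 2 * δ)
    (π : Equiv.Perm (Fin I.n)) (r : ℕ) :
    ∑ i ∈ ({i | l ≤ I.h i} : Finset (Fin I.n)) \ I.sample π r, I.cutLength g i * I.h i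
      - (∑ i with l ≤ I.h i, I.cutLength g i * I.h i) * ((∑ i ∈ I.sample π r,
        (if m ≤ I.h i then I.cutLength g i else 0)
          - (∑ i, if m ≤ I.h i then I.cutLength g i else 0) / 2) ^ 2 / δ ^ 2)
      ≤ I.accuracy * I.thresholdValue g ρ π r := by
  have hw := I.cutLength_pos hg
  have hV : ∀ i, 0 ≤ I.cutLength g i * I.h i := fun i => by
    have := hw i
    positivity
  have hC := I.accuracy_spec.1
  have hval0 : 0 ≤ I.thresholdValue g ρ π r := sum_nonneg fun i _ => I.gain_nonneg i _
  set X := I.sample π r with hXdef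
  rw [← sum_filter, ← sum_filter]
  set W := ∑ i with m ≤ I.h i, I.cutLength g i
  set A := ∑ i ∈ X with m ≤ I.h i, I.cutLength g i with hA
  have hVtop : 0 ≤ ∑ i with l ≤ I.h i, I.cutLength g i * I.h i := sum_nonneg fun i _ => hV i
  rcases le_or_gt A (W - I.T) with hbad | hgood
  -- Here `W / 2 - A ≥ T - W / 2 ≥ δ`, so the subtracted term exceeds all that could be read and the
  -- left side is nonpositive.
  · have hdev : 1 ≤ (A - W / 2) ^ 2 / δ ^ 2 := by
      rw [one_le_div (by positivity)]
      nlinarith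
    have h1 : ∑ i ∈ ({i | l ≤ I.h i} : Finset (Fin I.n)) \ X, I.cutLength g i * I.h i
        ≤ ∑ i with l ≤ I.h i, I.cutLength g i * I.h i :=
      sum_le_sum_of_subset_of_nonneg sdiff_subset fun i _ _ => hV i
    have h2 := mul_le_mul_of_nonneg_left hdev hVtop
    have h3 := mul_nonneg (zero_le_one.trans hC) hval0
    linarith
  · have hmX : (I.T : ℝ) / 2 < A := by linarith
    have hX : (I.T : ℝ) / 2 < ∑ i ∈ X, I.cutLength g i :=
      hmX.trans_le (sum_le_sum_of_subset_of_nonneg (filter_subset _ _) fun i _ _ => (hw i).le)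
    have hmem : ∀ i, i ∉ X ↔ r ≤ (π i : ℕ) := fun i => by simp [hXdef, sample]
    have hfit : ∑ j with r ≤ (π j : ℕ) ∧ ρ X ≤ I.h j, I.cutLength g j ≤ I.T := by
      have hsub : (univ.filter fun j => r ≤ (π j : ℕ) ∧ ρ X ≤ I.h j)
          ⊆ (univ.filter fun j => m ≤ I.h j) \ X := by
        intro j hj
        obtain ⟨-, hj1, hj2⟩ := mem_filter.1 hj
        refine mem_sdiff.2 ⟨mem_filter.2 ⟨mem_univ j, ?_⟩, (hmem j).2 hj1⟩
        by_contra! hjm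
        exact absurd hj2 (not_le.2 (I.lt_threshold hw (hρ X) hmX hjm))
      have h1 := sum_le_sum_of_subset_of_nonneg (f := I.cutLength g) hsub
        fun i _ _ => (hw i).le
      have h2 := sum_inter_add_sum_sdiff (univ.filter fun j => m ≤ I.h j) X (I.cutLength g)
      have h3 : (univ.filter fun j => m ≤ I.h j) ∩ X = X.filter fun j => m ≤ I.h j := by
        ext j
        simp [and_comm]
      rw [h3] at h2
      linarith
    have hread : ∀ i ∈ ({i | l ≤ I.h i} : Finset (Fin I.n)) \ X,
        I.cutLength g i * I.h i ≤ I.accuracy * I.gain i (I.readTime g π r (ρ X) i) := by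
      intro i hi
      obtain ⟨hi1, hi2⟩ := mem_sdiff.1 hi
      have hli : l ≤ I.h i := (mem_filter.1 hi1).2
      have hρl : ρ X ≤ I.h i := (I.threshold_le hw (hρ X) hX hl).trans (by exact_mod_cast hli)
      rw [I.readTime_eq_cutLength hg π hfit ⟨(hmem i).1 hi2, hρl⟩]
      exact I.hint_mul_le_accuracy_mul_gain hmono i (hw i).le (min_le_left _ _)
    have h1 : ∑ i ∈ ({i | l ≤ I.h i} : Finset (Fin I.n)) \ X, I.cutLength g i * I.h i
        ≤ I.accuracy * I.thresholdValue g ρ π r := by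
      refine (sum_le_sum hread).trans ?_
      rw [← mul_sum]
      exact mul_le_mul_of_nonneg_left (sum_le_sum_of_subset_of_nonneg (subset_univ _)
        fun i _ _ => I.gain_nonneg i _) (zero_le_one.trans hC)
    have h2 : 0 ≤ (∑ i with l ≤ I.h i, I.cutLength g i * I.h i)
        * ((A - W / 2) ^ 2 / δ ^ 2) := by positivity
    linarith

-- Averages the pointwise bound. Subtracting the Chebyshev term pointwise avoids any independence
-- between the bad event and the value missed by the sample.
open Finset in
theorem le_accuracy_mul_expectedThresholdValue {g : ℝ} (hg : 0 < g) (hmono : I.NonIncreasing)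
    {ρ : Finset (Fin I.n) → ℝ} (hρ : I.IsThresholdRule g ρ) {l m : ℕ}
    (hl : ∑ i with l ≤ I.h i, I.cutLength g i < (I.T : ℝ) / 2)
    (hm : 3 * (I.T : ℝ) / 2 ≤ ∑ i with m ≤ I.h i, I.cutLength g i) {δ : ℝ} (hδ : 0 < δ)
    (hm' : ∑ i with m ≤ I.h i, I.cutLength g i ≤ 2 * I.T - 2 * δ) :
    (∑ i with l ≤ I.h i, I.cutLength g i * I.h i)
        * (1 / 2 - (∑ i with m ≤ I.h i, I.cutLength g i ^ 2) / (4 * δ ^ 2))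
      ≤ I.accuracy * I.expectedThresholdValue g ρ := by
  set V := ∑ i with l ≤ I.h i, I.cutLength g i * I.h i with hV
  set a : Fin I.n → ℝ := fun i => if m ≤ I.h i then I.cutLength g i else 0 with ha
  let F : Finset (Fin I.n) → ℝ := fun X =>
    ∑ i ∈ ({i | l ≤ I.h i} : Finset (Fin I.n)) \ X, I.cutLength g i * I.h i
      - V * ((∑ i ∈ X, a i - (∑ i, a i) / 2) ^ 2 / δ ^ 2)
  have hF : (∑ X, F X) / 2 ^ I.n
      = V * (1 / 2 - (∑ i with m ≤ I.h i, I.cutLength g i ^ 2) / (4 * δ ^ 2)) := by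
    have h1 := sum_finset_sum_sdiff ({i | l ≤ I.h i} : Finset (Fin I.n))
      fun i => I.cutLength g i * I.h i
    have h2 := sum_powerset_sq_deviation a univ 0
    have h3 : ∑ i, a i ^ 2 = ∑ i with m ≤ I.h i, I.cutLength g i ^ 2 := by
      rw [sum_filter]
      refine sum_congr rfl fun i _ => ?_
      simp only [ha]
      split_ifs <;> simp
    simp only [powerset_univ, add_zero, card_univ, Fintype.card_fin, h3] at h1 h2
    simp only [F]
    rw [sum_sub_distrib, ← mul_sum, ← sum_div, h1, h2]
    field_simp
    ring
  rw [← hF, ← I.expectation_sample F, expectedThresholdValue, mul_sum]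
  refine sum_le_sum fun π _ => ?_
  rw [mul_left_comm]
  refine mul_le_mul_of_nonneg_left ?_ (by positivity)
  rw [mul_sum]
  refine sum_le_sum fun r _ => ?_
  rw [mul_left_comm]
  refine mul_le_mul_of_nonneg_left ?_ (by positivity)
  exact I.le_accuracy_mul_thresholdValue hg hmono hρ hl hm hδ hm' π r

end ReadingInstance

/-! ### Choice of the constants -/

theorem theorem2 (I : ReadingInstance)
    (hmono : I.NonIncreasing)
    (hlen : ∀ i, I.t i ≤ I.T)
    (hdistinct : Function.Injective I.h)
    (hcut : 3 * (I.T : ℝ) / 2 ≤ ∑ i, I.cutLength 0.0215 i) :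
    (∃ ρ, I.IsThresholdRule 0.0215 ρ) ∧
    (∀ ρ, I.IsThresholdRule 0.0215 ρ →
      1 / (246 * I.accuracy) * I.opt ≤ I.expectedThresholdValue 0.0215 ρ) ∧
    246 * I.accuracy < 90.5 * Real.exp 1 * I.accuracy := by
  have hg : (0 : ℝ) < 0.0215 := by norm_num
  have hT : (0 : ℝ) < I.T := by exact_mod_cast I.T_pos
  have hw := I.cutLength_pos hg
  have hwT : ∀ i, I.cutLength 0.0215 i ≤ 0.0215 * I.T := fun i => min_le_right _ _
  have hC : 0 < I.accuracy := zero_lt_one.trans_le I.accuracy_spec.1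
  refine ⟨?_, fun ρ hρ => ?_, ?_⟩
  · choose ρ hρ using fun X => I.exists_isThresholdHint hw hdistinct X (half_pos hT)
    exact ⟨ρ, hρ⟩
  · obtain ⟨k, -, hk1, hk2⟩ := exists_critical_item I.h (I.cutLength 0.0215) Finset.univ
      (mul_pos hg hT) (by linarith)
    obtain ⟨m, -, hm1, hm2⟩ := exists_critical_item I.h (I.cutLength 0.0215) Finset.univ
      (by positivity) hcut
    have hk3 := sum_filter_le_eq_add hdistinct (I.cutLength 0.0215) (Finset.mem_univ k)
    have hm3 := sum_filter_le_eq_add hdistinct (I.cutLength 0.0215) (Finset.mem_univ m)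
    -- The weight of M is at most 1.5215 T, and 2 - 2 · 0.239 = 1.522 just exceeds 1.5215.
    have hE := I.le_accuracy_mul_expectedThresholdValue hg hmono hρ (l := I.h k) (m := I.h m)
      (by linarith [hwT k]) hm2 (δ := 0.239 * I.T) (by positivity) (by linarith [hwT m])
    have hopt := I.mul_opt_le hg (by norm_num) hk2
    set V := ∑ i with I.h k ≤ I.h i, I.cutLength 0.0215 i * I.h i
    have hV : 0 ≤ V := Finset.sum_nonneg fun i _ => by
      have := hw i
      positivity
    have hsq : ∑ i with I.h m ≤ I.h i, I.cutLength 0.0215 i ^ 2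
        ≤ 0.0215 * I.T * (1.5215 * I.T) := by
      calc _ ≤ ∑ i with I.h m ≤ I.h i, 0.0215 * I.T * I.cutLength 0.0215 i :=
            Finset.sum_le_sum fun i _ => by
              rw [sq]
              exact mul_le_mul_of_nonneg_right (hwT i) (hw i).le
        _ ≤ _ := by
            rw [← Finset.mul_sum]
            exact mul_le_mul_of_nonneg_left (by linarith [hwT m]) (by positivity)
    -- The quotient is below 0.15, so 0.2 is generous; the final factor 1 / (0.3 · 0.0215) is below
    -- 156, well within 246.
    have hvar : (∑ i with I.h m ≤ I.h i, I.cutLength 0.0215 i ^ 2) / (4 * (0.239 * I.T) ^ 2)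
        ≤ 0.2 := by
      rw [div_le_iff₀ (by positivity)]
      nlinarith [mul_pos hT hT]
    have h1 : V * 0.3 ≤ I.accuracy * I.expectedThresholdValue 0.0215 ρ :=
      le_trans (mul_le_mul_of_nonneg_left (by linarith) hV) hE
    rw [one_div_mul_eq_div, div_le_iff₀ (by positivity)]
    linarith
  · have := Real.exp_one_gt_d9
    refine mul_lt_mul_of_pos_right ?_ hC
    linarith
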